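/- **Setting.** Let $n\ge 1$, $A\in\mathbb C^{N\times N}$ (possibly singular), $b,x_0\in\mathbb C^N$, $q_1,\dots,q_n\in\mathbb C^N$, and $r_0=b-Ax_0$. For $k\ge 1$ put $g_n(k)=\lfloor (k-1)/n\rfloor$ and $r_n(k)=k-n\,g_n(k)\in\{1,\dots,n\}$, and $p_k=(A^H)^{g_n(k)}q_{r_n(k)}$. We write $u\perp v$ if $u^Hv=0$. Let $\nu$ be the degree of the minimal polynomial of $r_0$ with respect to $A$, i.e. the least degree of a monic polynomial $p$ with $p(A)r_0=0$. For $1\le l\le\nu$ let $$\widehat W_l=[p_1,\dots,p_l]^H[r_0,Ar_0,\dots,A^{l-1}r_0],\qquad \widehat S_l=[p_1,\dots,p_l]^HA[r_0,Ar_0,\dots,A^{l-1}r_0].$$ **Algorithm 3** (ML($n$)BiCGStab, second version, exact arithmetic). Set $g_0=r_0$, $w_0=Ag_0$, $c_0=q_1^Hw_0$. For $k=1,2,\dots$ until convergence: set $\alpha_k=q_{r_n(k)}^Hr_{k-1}/c_{k-1}$. * If $r_n(k)<n$: $x_k=x_{k-1}+\alpha_kg_{k-1}$, $r_k=r_{k-1}-\alpha_kw_{k-1}$,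 $z=r_k$, $g_k=0$; for $s=\max(k-n,0),\dots,g_n(k)n-1$: $\tilde\beta=-q_{r_n(s+1)}^Hz/c_s$, $z\leftarrow z+\tilde\beta w_s$, $g_k\leftarrow g_k+\tilde\beta g_s$; then $g_k\leftarrow z+\frac1{\rho_{g_n(k+1)}}g_k$ (just $g_k\leftarrow z=r_k$ if $k<n$, when no $\rho$ exists yet and the loop is empty), $w_k=Ag_k$; for $s=g_n(k)n,\dots,k-1$: $\beta=-q_{r_n(s+1)}^Hw_k/c_s$, $w_k\leftarrow w_k+\beta w_s$, $g_k\leftarrow g_k+\beta g_s$. * If $r_n(k)=n$: $x_k=x_{k-1}+\alpha_kg_{k-1}$, $u_k=r_{k-1}-\alpha_kw_{k-1}$; if $u_k=0$, stop, with residual $r_k=u_k=0$; otherwise $\rho_{g_n(k+1)}=-(Au_k)^Hu_k/\|Au_k\|_2^2$, $x_k\leftarrow x_k-\rho_{g_n(k+1)}u_k$, $r_k=\rho_{g_n(k+1)}Au_k+u_k$, $z=r_k$, $g_k=0$; for $s=g_n(k)n,\dots,k-1$: $\tilde\beta=-q_{r_n(s+1)}^Hz/c_s$, $z\leftarrow z+\tilde\beta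 w_s$, $g_k\leftarrow g_k+\tilde\beta g_s$; then $g_k\leftarrow z+\frac1{\rho_{g_n(k+1)}}g_k$, $w_k=Ag_k$. In both cases finally $c_k=q_{r_n(k+1)}^Hw_k$. **Proposition.** Suppose that $\prod_{l=1}^{\nu}\det(\widehat S_l)\det(\widehat W_l)\neq 0$ and that every parameter $\rho_{g_n(k+1)}$ computed by the algorithm in an iteration $1\le k\le\nu-1$ (with $r_n(k)=n$) satisfies $\rho_{g_n(k+1)}\ne0$ and $-1/\rho_{g_n(k+1)}\notin\sigma(A)$. Then Algorithm 3 does not break down by zero division for $k=1,\dots,\nu$ (until it stops), and $x_\nu$ is an exact solution of $Ax=b$. Moreover: (a) For $1\le k\le\nu-1$: $x_k\in x_0+\operatorname{span}\{r_0,Ar_0,\dots,A^{g_n(k+1)+k-1}r_0\}$, and $r_k=b-Ax_k\in r_0+\operatorname{span}\{Ar_0,A^2r_0,\dots,A^{g_n(k+1)+k}r_0\}$. (b) $r_k\ne0$ for $1\le k\le\nu-1$, and $r_\nu=0$. (c) For $1\le k\le\nu-1$: if $r_n(k)<n$, then $r_k\perp\operatorname{span}\{q_1,\dots,q_{r_n(k)}\}$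 and $r_k\not\perp q_{r_n(k)+1}$; if $r_n(k)=n$, then $r_k\not\perp q_1$. (d) $u_k\perp\operatorname{span}\{q_1,\dots,q_n\}$ for $1\le k\le\nu$ with $r_n(k)=n$. (e) For $1\le k\le\nu-1$: if $r_n(k)<n$, then $Ag_k\perp\operatorname{span}\{q_1,\dots,q_{r_n(k)}\}$ and $Ag_k\not\perp q_{r_n(k)+1}$; if $r_n(k)=n$, then $Ag_k\not\perp q_1$. -/

import Mathlib

open Matrix

namespace MLBiCGStab

/-- Column vectors of length `N` with complex entries. -/
abbrev Vec (N : ℕ) := Fin N → ℂ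

/-- The inner product `u ^ H v`. -/
def herm {N : ℕ} (u v : Vec N) : ℂ := star u ⬝ᵥ v

/-- The Euclidean norm of a vector. -/
noncomputable def norm2 {N : ℕ} (v : Vec N) : ℝ := ‖(WithLp.toLp 2 v : EuclideanSpace ℂ (Fin N))‖

/-- The index function `g_n(k) = ⌊(k - 1) / n⌋`, used for `k ≥ 1` only. -/
def gIdx (n k : ℕ) : ℕ := (k - 1) / n

/-- The index function `r_n(k) = k - n g_n(k)`, used for `k ≥ 1` only. -/
def rIdx (n k : ℕ) : ℕ := k - n * gIdx n k

/-- For `k ≥ 1` no subtraction in the index functions truncates, and `r_n(k) ∈ {1, …, n}`. -/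
theorem idx_spec {n k : ℕ} (hn : 1 ≤ n) (hk : 1 ≤ k) :
    k = gIdx n k * n + rIdx n k ∧ 1 ≤ rIdx n k ∧ rIdx n k ≤ n := by
  have h1 := Nat.div_add_mod (k - 1) n
  have h2 := Nat.mod_lt (k - 1) (show 0 < n from hn)
  unfold rIdx gIdx
  rw [Nat.mul_comm ((k - 1) / n) n]
  omega

/-! ### Krylov spaces, the degree of the minimal polynomial, the moment matrices -/

/-- `span {A ^ a v, A ^ (a + 1) v, …, A ^ b v}`. -/
def krylov {N : ℕ} (A : Matrix (Fin N) (Fin N) ℂ) (v : Vec N) (a b : ℕ) : Submodule ℂ (Vec N) :=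
  Submodule.span ℂ ((fun t : ℕ => (A ^ t) *ᵥ v) '' Set.Icc a b)

/-- The degree of the minimal polynomial of `v` with respect to `A`, that is the least degree of
a monic polynomial `p` with `p(A) v = 0`. -/
noncomputable def minDegree {N : ℕ} (A : Matrix (Fin N) (Fin N) ℂ) (v : Vec N) : ℕ :=
  sInf {d : ℕ | ∃ p : Polynomial ℂ, p.Monic ∧ p.natDegree = d ∧ (Polynomial.aeval A p) *ᵥ v = 0}

/-- The infimum in `minDegree` is attained. -/
theorem minDegree_spec {N : ℕ} (A : Matrix (Fin N) (Fin N) ℂ) (v : Vec N) :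
    ∃ p : Polynomial ℂ, p.Monic ∧ p.natDegree = minDegree A v ∧
      (Polynomial.aeval A p) *ᵥ v = 0 := by
  have h : {d : ℕ | ∃ p : Polynomial ℂ, p.Monic ∧ p.natDegree = d ∧
      (Polynomial.aeval A p) *ᵥ v = 0}.Nonempty :=
    ⟨_, A.charpoly, A.charpoly_monic, rfl, by rw [Matrix.aeval_self_charpoly, Matrix.zero_mulVec]⟩
  exact Nat.sInf_mem h

/-- `p_k = (A ^ H) ^ (g_n(k)) q_(r_n(k))` for `k ≥ 1`. -/
def pVec {N : ℕ} (n : ℕ) (A : Matrix (Fin N) (Fin N) ℂ) (q : ℕ → Vec N) (k : ℕ) : Vec N :=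
  (Aᴴ ^ gIdx n k) *ᵥ q (rIdx n k)

/-- The `l × l` leading principal submatrix of
`[p_1, p_2, …] ^ H A [r₀, A r₀, A ^ 2 r₀, …]`. -/
def matS {N : ℕ} (n : ℕ) (A : Matrix (Fin N) (Fin N) ℂ) (q : ℕ → Vec N) (r₀ : Vec N) (l : ℕ) :
    Matrix (Fin l) (Fin l) ℂ :=
  Matrix.of fun i j => herm (pVec n A q (i + 1)) (A *ᵥ ((A ^ (j : ℕ)) *ᵥ r₀))

/-- The `l × l` leading principal submatrix of `[p_1, p_2, …] ^ H [r₀, A r₀, A ^ 2 r₀, …]`. -/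
def matW {N : ℕ} (n : ℕ) (A : Matrix (Fin N) (Fin N) ℂ) (q : ℕ → Vec N) (r₀ : Vec N) (l : ℕ) :
    Matrix (Fin l) (Fin l) ℂ :=
  Matrix.of fun i j => herm (pVec n A q (i + 1)) ((A ^ (j : ℕ)) *ᵥ r₀)

/-! ### The algorithm -/

/-- The quantities `x_k, r_k, u_k, g_k, w_k, c_k` which the algorithm holds at the end of
iteration `k`, and the current parameter `ρ = ρ_(g_n(k+1))`. -/
structure Iter (N : ℕ) where
  x : Vec N
  r : Vec N
  u : Vec N
  g : Vec N
  w : Vec N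
  c : ℂ
  ρ : ℂ

/-- The loop
`for s = a, …, b - 1: β = - q_(r_n(s+1)) ^ H z / c_s; z = z + β w_s; y = y + β g_s; end`,
started with the pair `(z, y)`. All inner loops of the algorithm have this form. -/
noncomputable def loop {N : ℕ} (n : ℕ) (q : ℕ → Vec N) (it : ℕ → Iter N) (a b : ℕ)
    (zy : Vec N × Vec N) : Vec N × Vec N :=
  (List.range' a (b - a)).foldl
    (fun st s =>
      let β : ℂ := -herm (q (rIdx n (s + 1))) st.1 / (it s).c
      (st.1 + β • (it s).w, st.2 + β • (it s).g)) zy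

/-- Iteration `k ≥ 1`, computed from the iterations `it s` with `s < k`.

If `r_n(k) < n`, the parameter is not changed because `g_n(k+1) = g_n(k)`, and `u_k = r_k`.
If `k < n`, no parameter has been computed yet and the first loop is empty, so that its second
component is `0` and `gk = zy.1` whatever the value of `ρ`.
The natural-number difference `k - n` is `max (k - n, 0)`. -/
noncomputable def step {N : ℕ} (n : ℕ) (A : Matrix (Fin N) (Fin N) ℂ) (q : ℕ → Vec N)
    (k : ℕ) (it : ℕ → Iter N) : Iter N :=
  let α : ℂ := herm (q (rIdx n k)) (it (k - 1)).r / (it (k - 1)).c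
  let x : Vec N := (it (k - 1)).x + α • (it (k - 1)).g
  let u : Vec N := (it (k - 1)).r - α • (it (k - 1)).w
  if rIdx n k < n then
    let ρ : ℂ := (it (k - 1)).ρ
    let zy := loop n q it (k - n) (gIdx n k * n) (u, 0)
    let gk : Vec N := zy.1 + (1 / ρ) • zy.2
    let wg := loop n q it (gIdx n k * n) k (A *ᵥ gk, gk)
    { x := x, r := u, u := u, g := wg.2, w := wg.1,
      c := herm (q (rIdx n (k + 1))) wg.1, ρ := ρ }
  else
    let ρ : ℂ := -herm (A *ᵥ u) u / ((norm2 (A *ᵥ u) ^ 2 : ℝ) : ℂ)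
    let r : Vec N := ρ • (A *ᵥ u) + u
    let zy := loop n q it (gIdx n k * n) k (r, 0)
    let gk : Vec N := zy.1 + (1 / ρ) • zy.2
    { x := x - ρ • u, r := r, u := u, g := gk, w := A *ᵥ gk,
      c := herm (q (rIdx n (k + 1))) (A *ᵥ gk), ρ := ρ }

/-- The initialization (the entries `u` and `ρ` are placeholders that are never used). -/
def init {N : ℕ} (A : Matrix (Fin N) (Fin N) ℂ) (b x₀ : Vec N) (q : ℕ → Vec N) : Iter N :=
  let r₀ : Vec N := b - A *ᵥ x₀
  { x := x₀, r := r₀, u := r₀, g := r₀, w := A *ᵥ r₀, c := herm (q 1) (A *ᵥ r₀), ρ := 0 }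

/-- The memory after `k` iterations: the entries `0, …, k` have been computed. -/
noncomputable def memory {N : ℕ} (n : ℕ) (A : Matrix (Fin N) (Fin N) ℂ) (b x₀ : Vec N)
    (q : ℕ → Vec N) : ℕ → (ℕ → Iter N)
  | 0 => fun _ => init A b x₀ q
  | k + 1 => Function.update (memory n A b x₀ q k) (k + 1)
      (step n A q (k + 1) (memory n A b x₀ q k))

/-- The `k`-th iterate of the algorithm, applied to the system `A x = b` with initial guess `x₀`
and shadow vectors `q 1, …, q n` (no other value of `q` is used). -/
noncomputable def iter {N : ℕ} (n : ℕ) (A : Matrix (Fin N) (Fin N) ℂ) (b x₀ : Vec N)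
    (q : ℕ → Vec N) (k : ℕ) : Iter N :=
  memory n A b x₀ q k k

/-- Iteration `k` meets no division by zero. The divisors of iteration `k` are the `c_s` with
`max (k - n, 0) ≤ s ≤ k - 1` (for `α_k` and the `β`s), and moreover
* if `r_n(k) < n`: the parameter `ρ_(g_n(k+1))`, which exists if `n ≤ k`;
* if `r_n(k) = n`: the number `‖A u_k‖ ^ 2` and the new parameter `ρ_(g_n(k+1))`, unless `u_k = 0`,
  in which case the algorithm stops right after the computation of `u_k` with the approximation
  `x_k = x_(k-1) + α_k g_(k-1)` and the residual `u_k = 0` (for `u_k = 0` the entries `x` and `r`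
  of `step` have these values, whatever the value of `ρ`). -/
def NoBreakdown {N : ℕ} (n : ℕ) (A : Matrix (Fin N) (Fin N) ℂ) (it : ℕ → Iter N) (k : ℕ) : Prop :=
  (∀ s, k - n ≤ s → s < k → (it s).c ≠ 0) ∧
  (rIdx n k < n → n ≤ k → (it k).ρ ≠ 0) ∧
  (rIdx n k = n → (it k).u = 0 ∨ (norm2 (A *ᵥ (it k).u) ^ 2 ≠ 0 ∧ (it k).ρ ≠ 0))

/-- `u ⊥ span {q_1, …, q_m}`. -/
def PerpSpan {N : ℕ} (u : Vec N) (q : ℕ → Vec N) (m : ℕ) : Prop :=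
  ∀ v ∈ Submodule.span ℂ (q '' Set.Icc 1 m), herm u v = 0

end MLBiCGStab

namespace MLBiCGStab

open Polynomial

variable {N n : ℕ}

/-! ### The Hermitian form -/

/-- The linear functional `v ↦ u ^ H v`. -/
def hermL (u : Vec N) : Vec N →ₗ[ℂ] ℂ where
  toFun v := herm u v
  map_add' v w := by simp [herm, dotProduct_add]
  map_smul' a v := by simp [herm, dotProduct_smul]

theorem herm_add (u v w : Vec N) : herm u (v + w) = herm u v + herm u w := (hermL u).map_add v w

theorem herm_smul (u : Vec N) (a : ℂ) (v : Vec N) : herm u (a • v) = a * herm u v :=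
  (hermL u).map_smul a v

theorem herm_zero (u : Vec N) : herm u 0 = 0 := (hermL u).map_zero

theorem star_herm (u v : Vec N) : star (herm u v) = herm v u := by
  rw [herm, herm, Matrix.star_dotProduct, star_star]

theorem herm_eq_zero_comm {u v : Vec N} : herm u v = 0 ↔ herm v u = 0 := by
  rw [← star_herm u v, star_eq_zero]

theorem herm_conjTranspose_mulVec (B : Matrix (Fin N) (Fin N) ℂ) (u v : Vec N) :
    herm (Bᴴ *ᵥ u) v = herm u (B *ᵥ v) := by
  simp [herm, Matrix.star_mulVec, Matrix.dotProduct_mulVec]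

theorem perpSpan_of_forall {u : Vec N} {q : ℕ → Vec N} {m : ℕ}
    (h : ∀ i < m, herm (q (i + 1)) u = 0) : PerpSpan u q m := by
  intro v hv
  have hle : Submodule.span ℂ (q '' Set.Icc 1 m) ≤ LinearMap.ker (hermL u) := by
    rw [Submodule.span_le]
    rintro _ ⟨i, ⟨hi1, him⟩, rfl⟩
    obtain ⟨j, rfl⟩ : ∃ j, i = j + 1 := ⟨i - 1, by omega⟩
    exact herm_eq_zero_comm.1 (h j (by omega))
  exact hle hv

/-! ### Index functions -/

theorem gIdx_succ (n k : ℕ) : gIdx n (k + 1) = k / n := rfl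

theorem rIdx_succ (n k : ℕ) : rIdx n (k + 1) = k % n + 1 := by
  have := Nat.div_add_mod k n
  simp only [rIdx, gIdx_succ]
  omega

theorem succ_div_of_mod_lt {k : ℕ} (h : k % n + 1 < n) : (k + 1) / n = k / n :=
  Nat.succ_div_of_not_dvd fun hd => by
    have := Nat.mod_add_div k n
    have h1 : (k % n + 1 + n * (k / n)) % n = 0 := by
      rw [show k % n + 1 + n * (k / n) = k + 1 by omega]; exact Nat.mod_eq_zero_of_dvd hd
    rw [Nat.add_mul_mod_self_left, Nat.mod_eq_of_lt h] at h1
    omega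

theorem succ_eq_of_mod_eq {k : ℕ} (h : k % n + 1 = n) : k + 1 = (k / n + 1) * n := by
  have := Nat.mod_add_div k n
  rw [add_mul, mul_comm]
  omega

theorem succ_div_of_mod_eq {k : ℕ} (h : k % n + 1 = n) : (k + 1) / n = k / n + 1 := by
  rw [succ_eq_of_mod_eq h, Nat.mul_div_cancel _ (by omega)]

/-! ### Polynomials in `A` applied to a vector -/

theorem _root_.Polynomial.linearMap_eq_sum_range {M : Type*} [AddCommGroup M] [Module ℂ M]
    (f : ℂ[X] →ₗ[ℂ] M) {P : ℂ[X]} {l : ℕ} (h : P.natDegree < l) :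
    f P = ∑ j ∈ Finset.range l, P.coeff j • f (X ^ j) := by
  conv_lhs => rw [P.as_sum_range' l h]
  simp [map_sum, ← Polynomial.smul_X_eq_monomial]

/-- The vector `P(A) v`, linearly in `P`. -/
noncomputable def evalVec (A : Matrix (Fin N) (Fin N) ℂ) (v : Vec N) : ℂ[X] →ₗ[ℂ] Vec N where
  toFun P := aeval A P *ᵥ v
  map_add' P Q := by simp [Matrix.add_mulVec]
  map_smul' a P := by simp [Matrix.smul_mulVec]

variable {A : Matrix (Fin N) (Fin N) ℂ} {v : Vec N}

theorem evalVec_apply (P : ℂ[X]) : evalVec A v P = aeval A P *ᵥ v := rfl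

theorem evalVec_one : evalVec A v 1 = v := by simp [evalVec_apply]

theorem evalVec_mul (P Q : ℂ[X]) : evalVec A v (P * Q) = aeval A P *ᵥ evalVec A v Q := by
  simp [evalVec_apply]

theorem evalVec_X_mul (P : ℂ[X]) : evalVec A v (X * P) = A *ᵥ evalVec A v P := by
  simp [evalVec_mul]

theorem evalVec_X_pow (j : ℕ) : evalVec A v (X ^ j) = A ^ j *ᵥ v := by
  simp [evalVec_apply]

theorem evalVec_C_mul (a : ℂ) (P : ℂ[X]) : evalVec A v (C a * P) = a • evalVec A v P := by
  rw [← Polynomial.smul_eq_C_mul, map_smul]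

theorem evalVec_mem_krylov {P : ℂ[X]} {a d : ℕ} (h0 : ∀ j < a, P.coeff j = 0)
    (hd : P.natDegree ≤ d) : evalVec A v P ∈ krylov A v a d := by
  rw [Polynomial.linearMap_eq_sum_range (evalVec A v) (Nat.lt_succ_of_le hd)]
  refine Submodule.sum_mem _ fun j hj => ?_
  by_cases hja : j < a
  · simp [h0 j hja]
  · refine Submodule.smul_mem _ _ (Submodule.subset_span ⟨j, ⟨by omega, ?_⟩, ?_⟩)
    · have := Finset.mem_range.1 hj; omega
    · exact evalVec_X_pow j |>.symm

theorem evalVec_eq_zero_of_one_add {ρ : ℂ} (hρ : ρ ≠ 0) (hs : -1 / ρ ∉ spectrum ℂ A) {P : ℂ[X]}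
    (h : evalVec A v ((1 + C ρ * X) * P) = 0) : evalVec A v P = 0 := by
  rw [spectrum.notMem_iff] at hs
  have h1 : (algebraMap ℂ (Matrix (Fin N) (Fin N) ℂ) (-1 / ρ) - A) *ᵥ evalVec A v P = 0 := by
    have h2 : algebraMap ℂ (Matrix (Fin N) (Fin N) ℂ) (-1 / ρ) - A
        = aeval A (C (-1 / ρ) * (1 + C ρ * X)) := by
      have h3 : C (-1 / ρ) * (1 + C ρ * X) = C (-1 / ρ) - (X : ℂ[X]) := by
        have : C (-1 / ρ) * C ρ = (-1 : ℂ[X]) := by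
          rw [← C_mul, div_mul_cancel₀ _ hρ]; simp
        linear_combination X * this
      rw [h3]; simp
    rw [h2, ← evalVec_mul, mul_assoc, evalVec_C_mul, h, smul_zero]
  obtain ⟨B, hB⟩ := hs.exists_left_inv
  calc evalVec A v P = (B * (algebraMap ℂ (Matrix (Fin N) (Fin N) ℂ) (-1 / ρ) - A)) *ᵥ
        evalVec A v P := by rw [hB, Matrix.one_mulVec]
    _ = 0 := by rw [← Matrix.mulVec_mulVec, h1, Matrix.mulVec_zero]

/-! ### Moments -/

/-- The functional `P ↦ p_(k+1) ^ H P(A) v`. -/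
noncomputable def moment (n : ℕ) (A : Matrix (Fin N) (Fin N) ℂ) (q : ℕ → Vec N) (v : Vec N)
    (k : ℕ) : ℂ[X] →ₗ[ℂ] ℂ :=
  hermL (q (k % n + 1)) ∘ₗ evalVec A v ∘ₗ LinearMap.mulLeft ℂ (X ^ (k / n))

variable {q : ℕ → Vec N}

theorem moment_apply (k : ℕ) (P : ℂ[X]) :
    moment n A q v k P = herm (q (k % n + 1)) (evalVec A v (X ^ (k / n) * P)) := rfl

theorem herm_pVec_evalVec (k : ℕ) (P : ℂ[X]) :
    herm (pVec n A q (k + 1)) (evalVec A v P) = moment n A q v k P := by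
  rw [moment_apply, pVec, gIdx_succ, rIdx_succ, ← Matrix.conjTranspose_pow,
    herm_conjTranspose_mulVec, evalVec_mul]
  simp

theorem moment_C_mul (k : ℕ) (a : ℂ) (P : ℂ[X]) :
    moment n A q v k (C a * P) = a * moment n A q v k P := by
  rw [← Polynomial.smul_eq_C_mul, map_smul, smul_eq_mul]

theorem moment_X_mul (hn : 1 ≤ n) (k : ℕ) (P : ℂ[X]) :
    moment n A q v k (X * P) = moment n A q v (k + n) P := by
  rw [moment_apply, moment_apply, Nat.add_mod_right, Nat.add_div_right _ (by omega), pow_succ,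
    mul_assoc]

theorem eq_zero_of_moment_eq_zero {l : ℕ} (hdet : (matW n A q v l).det ≠ 0) {P : ℂ[X]}
    (hP : P.natDegree < l) (h : ∀ i < l, moment n A q v i P = 0) : P = 0 := by
  have h0 : matW n A q v l *ᵥ (fun j : Fin l => P.coeff j) = 0 := by
    ext i
    have := h i i.2
    rw [Polynomial.linearMap_eq_sum_range _ hP, Finset.sum_range] at this
    rw [Pi.zero_apply, ← this]
    simp only [Matrix.mulVec, dotProduct, matW, Matrix.of_apply, smul_eq_mul]
    refine Finset.sum_congr rfl fun j _ => ?_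
    rw [← evalVec_X_pow, herm_pVec_evalVec, mul_comm]
  have h1 := Matrix.eq_zero_of_mulVec_eq_zero hdet h0
  ext j
  by_cases hj : j < l
  · simpa using congrFun h1 ⟨j, hj⟩
  · simpa using Polynomial.coeff_eq_zero_of_natDegree_lt (by omega)

theorem eq_zero_of_moment_X_mul_eq_zero {l : ℕ} (hdet : (matS n A q v l).det ≠ 0) {P : ℂ[X]}
    (hP : P.natDegree < l) (h : ∀ i < l, moment n A q v i (X * P) = 0) : P = 0 := by
  have h0 : matS n A q v l *ᵥ (fun j : Fin l => P.coeff j) = 0 := by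
    ext i
    have := h i i.2
    rw [← LinearMap.mulLeft_apply (R := ℂ), ← LinearMap.comp_apply,
      Polynomial.linearMap_eq_sum_range _ hP, Finset.sum_range] at this
    rw [Pi.zero_apply, ← this]
    simp only [Matrix.mulVec, dotProduct, matS, Matrix.of_apply, smul_eq_mul,
      LinearMap.comp_apply, LinearMap.mulLeft_apply]
    refine Finset.sum_congr rfl fun j _ => ?_
    rw [← evalVec_X_pow, ← evalVec_X_mul, herm_pVec_evalVec, mul_comm]
  have h1 := Matrix.eq_zero_of_mulVec_eq_zero hdet h0
  ext j
  by_cases hj : j < l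
  · simpa using congrFun h1 ⟨j, hj⟩
  · simpa using Polynomial.coeff_eq_zero_of_natDegree_lt (by omega)

theorem herm_evalVec_mul_eq_sum {i d : ℕ} (hi : i < n) {φ : ℂ[X]} (hφ : φ.natDegree ≤ d)
    (P : ℂ[X]) : herm (q (i + 1)) (evalVec A v (φ * P)) =
      ∑ t ∈ Finset.range (d + 1), φ.coeff t * moment n A q v (t * n + i) P := by
  have := Polynomial.linearMap_eq_sum_range
    (hermL (q (i + 1)) ∘ₗ evalVec A v ∘ₗ LinearMap.mulRight ℂ P) (Nat.lt_succ_of_le hφ)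
  refine this.trans (Finset.sum_congr rfl fun t _ => ?_)
  rw [moment_apply, mul_comm t n, Nat.mul_add_mod, Nat.mod_eq_of_lt hi,
    Nat.mul_add_div (by omega), Nat.div_eq_of_lt hi]
  rfl

theorem herm_evalVec_mul_eq_zero {i d k : ℕ} (hi : i < n) {φ : ℂ[X]} (hφ : φ.natDegree ≤ d)
    {P : ℂ[X]} (hP : ∀ j < k, moment n A q v j P = 0) (hk : d * n + i < k) :
    herm (q (i + 1)) (evalVec A v (φ * P)) = 0 := by
  rw [herm_evalVec_mul_eq_sum hi hφ]
  refine Finset.sum_eq_zero fun t ht => ?_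
  have : t * n ≤ d * n := Nat.mul_le_mul_right _ (by have := Finset.mem_range.1 ht; omega)
  rw [hP _ (by omega), mul_zero]

theorem herm_evalVec_mul_eq_coeff (hn : 1 ≤ n) {s : ℕ} {φ : ℂ[X]} (hφ : φ.natDegree ≤ s / n)
    {P : ℂ[X]} (hP : ∀ j < s, moment n A q v j P = 0) :
    herm (q (s % n + 1)) (evalVec A v (φ * P)) = φ.coeff (s / n) * moment n A q v s P := by
  have hs := Nat.div_add_mod s n
  rw [mul_comm] at hs
  rw [herm_evalVec_mul_eq_sum (Nat.mod_lt s hn) hφ, Finset.sum_range_succ, hs, add_eq_right]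
  refine Finset.sum_eq_zero fun t ht => ?_
  have : (t + 1) * n ≤ s / n * n :=
    Nat.mul_le_mul_right _ (by have := Finset.mem_range.1 ht; omega)
  rw [add_mul] at this
  rw [hP _ (by omega), mul_zero]

/-! ### Unfolding the algorithm -/

theorem loop_self (it : ℕ → Iter N) (a : ℕ) (zy : Vec N × Vec N) : loop n q it a a zy = zy := by
  simp [loop]

theorem loop_succ (it : ℕ → Iter N) {a b : ℕ} (hab : a ≤ b) (zy : Vec N × Vec N) :
    loop n q it a (b + 1) zy =
      ((loop n q it a b zy).1 +
          (-herm (q (b % n + 1)) (loop n q it a b zy).1 / (it b).c) • (it b).w,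
        (loop n q it a b zy).2 +
          (-herm (q (b % n + 1)) (loop n q it a b zy).1 / (it b).c) • (it b).g) := by
  have h : b + 1 - a = (b - a) + 1 := by omega
  simp only [loop, h, List.range'_1_concat, List.foldl_append, List.foldl_cons, List.foldl_nil]
  rw [show a + (b - a) = b by omega, rIdx_succ]

theorem loop_congr {it it' : ℕ → Iter N} {a b : ℕ} (h : ∀ s < b, it s = it' s)
    (zy : Vec N × Vec N) : loop n q it a b zy = loop n q it' a b zy := by
  by_cases hab : a ≤ b
  · induction b, hab using Nat.le_induction with
    | base => rw [loop_self, loop_self]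
    | succ b hab ih =>
      rw [loop_succ it hab, loop_succ it' hab, ih fun s hs => h s (by omega), h b (by omega)]
  · simp [loop, Nat.sub_eq_zero_of_le (not_le.1 hab).le]

theorem step_congr {it it' : ℕ → Iter N} {k : ℕ} (h : ∀ s ≤ k, it s = it' s) :
    step n A q (k + 1) it = step n A q (k + 1) it' := by
  have hle : gIdx n (k + 1) * n ≤ k := Nat.div_mul_le_self k n
  simp only [step, Nat.add_sub_cancel, h k le_rfl,
    loop_congr (n := n) (q := q) (b := gIdx n (k + 1) * n) fun s hs => h s (by omega),
    loop_congr (n := n) (q := q) (b := k + 1) fun s hs => h s (by omega)]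

theorem memory_eq_iter (b x₀ : Vec N) {k s : ℕ} (hs : s ≤ k) :
    memory n A b x₀ q k s = iter n A b x₀ q s := by
  induction k, hs using Nat.le_induction with
  | base => rfl
  | succ k hk ih => rw [memory, Function.update_of_ne (by omega), ih]

theorem iter_zero (b x₀ : Vec N) : iter n A b x₀ q 0 = init A b x₀ q := rfl

theorem iter_succ (b x₀ : Vec N) (k : ℕ) :
    iter n A b x₀ q (k + 1) = step n A q (k + 1) (iter n A b x₀ q) := by
  rw [iter, memory, Function.update_self]
  exact step_congr fun s hs => memory_eq_iter b x₀ hs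

/-! ### The stabilizing polynomials -/

/-- The product of the factors `1 + ρ_t X` over `1 ≤ t ≤ j`. -/
noncomputable def stabPoly (n : ℕ) (it : ℕ → Iter N) (j : ℕ) : ℂ[X] :=
  ∏ t ∈ Finset.range j, (1 + C (it ((t + 1) * n)).ρ * X)

theorem stabPoly_zero (it : ℕ → Iter N) : stabPoly n it 0 = 1 := rfl

theorem stabPoly_succ (it : ℕ → Iter N) (j : ℕ) :
    stabPoly n it (j + 1) = stabPoly n it j * (1 + C (it ((j + 1) * n)).ρ * X) :=
  Finset.prod_range_succ _ _

theorem natDegree_one_add_C_mul_X_le (a : ℂ) : (1 + C a * X : ℂ[X]).natDegree ≤ 1 := by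
  rw [add_comm]; exact natDegree_linear_le (b := (1 : ℂ))

theorem natDegree_stabPoly_le (it : ℕ → Iter N) (j : ℕ) : (stabPoly n it j).natDegree ≤ j := by
  induction j with
  | zero => simp [stabPoly_zero]
  | succ j ih =>
    rw [stabPoly_succ]
    exact natDegree_mul_le_of_le ih (natDegree_one_add_C_mul_X_le _)

theorem coeff_stabPoly_ne_zero {it : ℕ → Iter N} {j : ℕ}
    (h : ∀ t < j, (it ((t + 1) * n)).ρ ≠ 0) : (stabPoly n it j).coeff j ≠ 0 := by
  induction j with
  | zero => simp [stabPoly_zero]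
  | succ j ih =>
    rw [stabPoly_succ, coeff_mul_add_eq_of_natDegree_le (natDegree_stabPoly_le it j)
      (natDegree_one_add_C_mul_X_le _)]
    refine mul_ne_zero (ih fun t ht => h t (by omega)) ?_
    simpa [coeff_one] using h j (by omega)

theorem evalVec_eq_zero_of_stabPoly_mul {it : ℕ → Iter N} {j : ℕ}
    (h : ∀ t < j, (it ((t + 1) * n)).ρ ≠ 0 ∧ -1 / (it ((t + 1) * n)).ρ ∉ spectrum ℂ A) {P : ℂ[X]}
    (hP : evalVec A v (stabPoly n it j * P) = 0) : evalVec A v P = 0 := by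
  induction j with
  | zero => simpa [stabPoly_zero] using hP
  | succ j ih =>
    refine ih (fun t ht => h t (by omega)) ?_
    rw [stabPoly_succ, mul_comm (stabPoly n it j), mul_assoc] at hP
    exact evalVec_eq_zero_of_one_add (h j (by omega)).1 (h j (by omega)).2 hP

/-! ### The inner loops -/

/-- The direction held after iteration `s` is represented, relative to the factor `ψ`, by a
polynomial `Q` of degree at most `s` such that `X Q` has its first nonzero moment at `s`. -/
structure DirRep (n : ℕ) (A : Matrix (Fin N) (Fin N) ℂ) (q : ℕ → Vec N) (v : Vec N) (ψ : ℂ[X])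
    (s : ℕ) (st : Iter N) (Q : ℂ[X]) : Prop where
  natDegree_le : Q.natDegree ≤ s
  moment_eq : ∀ i < s, moment n A q v i (X * Q) = 0
  moment_ne : moment n A q v s (X * Q) ≠ 0
  g_eq : st.g = evalVec A v (ψ * Q)
  w_eq : st.w = evalVec A v (ψ * (X * Q))
  c_eq : st.c = herm (q (s % n + 1)) st.w

theorem DirRep.c_eq_mul {ψ : ℂ[X]} {s : ℕ} {st : Iter N} {Q : ℂ[X]}
    (h : DirRep n A q v ψ s st Q) (hn : 1 ≤ n) (hψ : ψ.natDegree ≤ s / n) :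
    st.c = ψ.coeff (s / n) * moment n A q v s (X * Q) := by
  rw [h.c_eq, h.w_eq, herm_evalVec_mul_eq_coeff hn hψ h.moment_eq]

theorem loop_spec (hn : 1 ≤ n) {it : ℕ → Iter N} {a b d : ℕ} (hab : a ≤ b)
    (hd : ∀ s, a ≤ s → s < b → s / n = d) {ψ : ℂ[X]} (hψ : ψ.natDegree ≤ d) (hψd : ψ.coeff d ≠ 0)
    (hQ : ∀ s, a ≤ s → s < b → ∃ Q, DirRep n A q v ψ s (it s) Q) {T : ℂ[X]}
    (hT : ∀ i < a, moment n A q v i (X * T) = 0) {ρ : ℂ} {z : Vec N}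
    (hz : ∀ s, a ≤ s → s < b →
      herm (q (s % n + 1)) z = ρ * herm (q (s % n + 1)) (evalVec A v (ψ * (X * T))))
    (y : Vec N) :
    ∃ B : ℂ[X], B.degree < b ∧ (∀ i < b, moment n A q v i (X * (T + B)) = 0) ∧
      loop n q it a b (z, y) =
        (z + ρ • evalVec A v (ψ * (X * B)), y + ρ • evalVec A v (ψ * B)) := by
  induction b, hab using Nat.le_induction with
  | base => exact ⟨0, by simp, by simpa using hT, by simp [loop_self]⟩
  | succ b hab ih =>
    obtain ⟨B, hB, hTB, hloop⟩ := ih (fun s h1 h2 => hd s h1 (by omega))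
      (fun s h1 h2 => hQ s h1 (by omega)) (fun s h1 h2 => hz s h1 (by omega))
    obtain ⟨Q, hQb⟩ := hQ b hab (by omega)
    have hbd := hd b hab (by omega)
    set β : ℂ := -moment n A q v b (X * (T + B)) / moment n A q v b (X * Q) with hβ
    have hcoef : -herm (q (b % n + 1)) (z + ρ • evalVec A v (ψ * (X * B))) / (it b).c = ρ * β := by
      rw [herm_add, herm_smul, hz b hab (by omega), ← mul_add, ← herm_add, ← map_add, ← mul_add,
        ← mul_add, herm_evalVec_mul_eq_coeff hn (by rw [hbd]; exact hψ) hTB,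
        hQb.c_eq_mul hn (by rw [hbd]; exact hψ), hbd, hβ]
      have := hQb.moment_ne
      field_simp
    refine ⟨B + C β * Q, ?_, fun i hi => ?_, ?_⟩
    · refine (degree_add_le _ _).trans_lt (max_lt (hB.trans (by exact_mod_cast b.lt_succ_self)) ?_)
      refine (degree_le_of_natDegree_le ((natDegree_C_mul_le _ _).trans hQb.natDegree_le)).trans_lt
        (by exact_mod_cast b.lt_succ_self)
    · rw [show X * (T + (B + C β * Q)) = X * (T + B) + C β * (X * Q) by ring, map_add, moment_C_mul]
      rcases Nat.lt_succ_iff_lt_or_eq.1 hi with hi | rfl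
      · rw [hTB i hi, hQb.moment_eq i hi]; simp
      · rw [hβ, div_mul_cancel₀ _ hQb.moment_ne]; ring
    · rw [loop_succ it hab, hloop]
      simp only [hcoef, hQb.w_eq, hQb.g_eq]
      rw [show ψ * (X * (B + C β * Q)) = ψ * (X * B) + C β * (ψ * (X * Q)) by ring,
        show ψ * (B + C β * Q) = ψ * B + C β * (ψ * Q) by ring, map_add, map_add, evalVec_C_mul,
        evalVec_C_mul, smul_add, smul_add, smul_smul, smul_smul, add_assoc, add_assoc]

variable {x₀ : Vec N}

/-! ### Residuals -/

/-- The approximation `x` and the vector `u` are represented, relative to the factor `ψ`, by a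
residual polynomial `P` of degree at most `k` whose first `k` moments vanish. -/
structure ResRep (n : ℕ) (A : Matrix (Fin N) (Fin N) ℂ) (q : ℕ → Vec N) (v x₀ : Vec N) (ψ : ℂ[X])
    (k : ℕ) (x u : Vec N) (P Y : ℂ[X]) : Prop where
  natDegree_le : P.natDegree ≤ k
  coeff_zero : P.coeff 0 = 1
  moment_eq : ∀ i < k, moment n A q v i P = 0
  u_eq : u = evalVec A v (ψ * P)
  x_eq : x - x₀ = evalVec A v Y
  mul_add : ψ * P + X * Y = 1

namespace ResRep

variable {ψ P Y : ℂ[X]} {k : ℕ} {x u : Vec N}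

theorem eq_sub_mulVec (h : ResRep n A q v x₀ ψ k x u P Y) {b : Vec N} (hv : v = b - A *ᵥ x₀) :
    u = b - A *ᵥ x := by
  have h1 := congrArg (evalVec A v) h.mul_add
  rw [map_add, ← h.u_eq, evalVec_X_mul, ← h.x_eq, evalVec_one, Matrix.mulVec_sub, hv] at h1
  rw [← sub_eq_zero] at h1 ⊢
  rw [← h1]
  abel

theorem sub_mem_krylov (h : ResRep n A q v x₀ ψ k x u P Y) {d : ℕ} (hψ : ψ.natDegree ≤ d) :
    u - v ∈ krylov A v 1 (d + k) := by
  have h1 : u - v = evalVec A v (ψ * P - 1) := by rw [map_sub, ← h.u_eq, evalVec_one]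
  rw [h1]
  refine evalVec_mem_krylov (fun j hj => ?_) ?_
  · obtain rfl : j = 0 := by omega
    rw [← h.mul_add, coeff_sub, coeff_add, coeff_X_mul_zero]
    ring
  · exact (natDegree_sub_le_of_le (natDegree_mul_le_of_le hψ h.natDegree_le) (by simp)).trans
      (max_le le_rfl (Nat.zero_le _))

theorem sub_mem_krylov_zero (h : ResRep n A q v x₀ ψ k x u P Y) {d : ℕ} (hψ : ψ.natDegree ≤ d) :
    x - x₀ ∈ krylov A v 0 (d + k - 1) := by
  rw [h.x_eq]
  refine evalVec_mem_krylov (fun j hj => absurd hj (by omega)) ?_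
  by_cases hY : Y = 0
  · simp [hY]
  have h1 : X * Y = 1 - ψ * P := by rw [← h.mul_add]; ring
  have h2 : (X * Y).natDegree ≤ d + k := by
    rw [h1]
    exact (natDegree_sub_le_of_le (by simp) (natDegree_mul_le_of_le hψ h.natDegree_le)).trans
      (max_le (Nat.zero_le _) le_rfl)
  rw [natDegree_X_mul hY] at h2
  omega

theorem ne_zero (h : ResRep n A q v x₀ ψ k x u P Y) : P ≠ 0 := by
  intro h0
  have := h.coeff_zero
  simp [h0] at this

theorem moment_ne (h : ResRep n A q v x₀ ψ k x u P Y) (hW : (matW n A q v (k + 1)).det ≠ 0) :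
    moment n A q v k P ≠ 0 := by
  intro h0
  refine h.ne_zero (eq_zero_of_moment_eq_zero hW (Nat.lt_succ_of_le h.natDegree_le) fun i hi => ?_)
  rcases Nat.lt_succ_iff_lt_or_eq.1 hi with hi | rfl
  exacts [h.moment_eq i hi, h0]

theorem not_degree_lt (h : ResRep n A q v x₀ ψ k x u P Y) (hW : (matW n A q v k).det ≠ 0) :
    ¬ P.degree < k := fun hP =>
  h.ne_zero (eq_zero_of_moment_eq_zero hW ((natDegree_lt_iff_degree_lt h.ne_zero).2 hP) h.moment_eq)

theorem evalVec_X_mul_ne_zero (h : ResRep n A q v x₀ ψ k x u P Y)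
    (hS : (matS n A q v (k + 1)).det ≠ 0) : evalVec A v (X * P) ≠ 0 := by
  intro h0
  refine h.ne_zero (eq_zero_of_moment_X_mul_eq_zero hS (Nat.lt_succ_of_le h.natDegree_le)
    fun i _ => ?_)
  rw [← herm_pVec_evalVec, h0, herm_zero]

end ResRep

theorem exists_monic_evalVec_eq_zero (A : Matrix (Fin N) (Fin N) ℂ) (v : Vec N) :
    ∃ p : ℂ[X], p.Monic ∧ p.natDegree = minDegree A v ∧ evalVec A v p = 0 :=
  minDegree_spec A v

theorem evalVec_eq_zero_of_moment_eq_zero {P : ℂ[X]}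
    (hW : (matW n A q v (minDegree A v)).det ≠ 0)
    (h : ∀ i < minDegree A v, moment n A q v i P = 0) : evalVec A v P = 0 := by
  obtain ⟨p, hp, hpd, hp0⟩ := exists_monic_evalVec_eq_zero A v
  have hmul : ∀ R : ℂ[X], evalVec A v (R * p) = 0 := fun R => by
    rw [evalVec_mul, hp0, Matrix.mulVec_zero]
  have hmod : evalVec A v (P %ₘ p) = evalVec A v P := by
    conv_rhs => rw [← modByMonic_add_div P p, map_add, mul_comm p, hmul, add_zero]
  rw [← hmod]
  by_cases hp1 : p = 1
  · simp [hp1]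
  have h0 : P %ₘ p = 0 :=
    eq_zero_of_moment_eq_zero hW (hpd ▸ natDegree_modByMonic_lt P hp hp1) fun i hi => by
      rw [← herm_pVec_evalVec, hmod, herm_pVec_evalVec, h i hi]
  rw [h0, map_zero]

/-! ### One iteration -/

variable {it : ℕ → Iter N} {k : ℕ}

theorem step_u : (step n A q (k + 1) it).u = (it k).r -
    (herm (q (k % n + 1)) (it k).r / (it k).c) • (it k).w := by
  simp only [step, rIdx_succ, Nat.add_sub_cancel]
  split_ifs <;> rfl

theorem step_c : (step n A q (k + 1) it).c =
    herm (q ((k + 1) % n + 1)) (step n A q (k + 1) it).w := by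
  rw [← rIdx_succ n (k + 1)]
  simp only [step]
  split_ifs <;> rfl

theorem step_x_of_lt (h : k % n + 1 < n) : (step n A q (k + 1) it).x = (it k).x +
    (herm (q (k % n + 1)) (it k).r / (it k).c) • (it k).g := by
  simp only [step, rIdx_succ, Nat.add_sub_cancel, if_pos h]

theorem step_r_of_lt (h : k % n + 1 < n) :
    (step n A q (k + 1) it).r = (step n A q (k + 1) it).u := by
  simp only [step, rIdx_succ, Nat.add_sub_cancel, if_pos h]

theorem step_ρ_of_lt (h : k % n + 1 < n) : (step n A q (k + 1) it).ρ = (it k).ρ := by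
  simp only [step, rIdx_succ, Nat.add_sub_cancel, if_pos h]

theorem step_x_of_eq (h : k % n + 1 = n) : (step n A q (k + 1) it).x = (it k).x +
    (herm (q (k % n + 1)) (it k).r / (it k).c) • (it k).g -
      (step n A q (k + 1) it).ρ • (step n A q (k + 1) it).u := by
  simp only [step, rIdx_succ, Nat.add_sub_cancel, if_neg h.not_lt]

theorem step_r_of_eq (h : k % n + 1 = n) : (step n A q (k + 1) it).r =
    (step n A q (k + 1) it).ρ • (A *ᵥ (step n A q (k + 1) it).u) +
      (step n A q (k + 1) it).u := by
  simp only [step, rIdx_succ, Nat.add_sub_cancel, if_neg h.not_lt]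

theorem step_wg (hn : 1 ≤ n) (zy : Vec N × Vec N)
    (hzy : zy = loop n q it (k + 1 - n) ((k + 1) / n * n) ((step n A q (k + 1) it).r, 0))
    (g : Vec N) (hg : g = zy.1 + (1 / (step n A q (k + 1) it).ρ) • zy.2) :
    ((step n A q (k + 1) it).w, (step n A q (k + 1) it).g) =
      loop n q it ((k + 1) / n * n) (k + 1) (A *ᵥ g, g) := by
  subst hg hzy
  rcases lt_or_eq_of_le (Nat.succ_le_of_lt (Nat.mod_lt k hn)) with h | h
  · rw [succ_div_of_mod_lt h]
    simp only [step, rIdx_succ, gIdx_succ, if_pos (show k % n + 1 < n from h)]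
  · replace h : k % n + 1 = n := h
    have h1 : k + 1 - n = k / n * n := by
      rw [succ_eq_of_mod_eq h, add_mul, one_mul, Nat.add_sub_cancel]
    rw [succ_div_of_mod_eq h, ← succ_eq_of_mod_eq h, loop_self, h1]
    simp only [step, rIdx_succ, gIdx_succ, if_neg h.not_lt]

theorem exists_resRep_half (hn : 1 ≤ n) (hstep : it (k + 1) = step n A q (k + 1) it)
    (hρ : ∀ t < k / n, (it ((t + 1) * n)).ρ ≠ 0) {P Y Q : ℂ[X]}
    (hP : ResRep n A q v x₀ (stabPoly n it (k / n)) k (it k).x (it k).r P Y)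
    (hQ : DirRep n A q v (stabPoly n it (k / n)) k (it k) Q) :
    ∃ P' Y', ResRep n A q v x₀ (stabPoly n it (k / n)) (k + 1)
      ((it k).x + (herm (q (k % n + 1)) (it k).r / (it k).c) • (it k).g) (it (k + 1)).u P' Y' := by
  set ψ := stabPoly n it (k / n) with hψ
  have hψd : ψ.natDegree ≤ k / n := natDegree_stabPoly_le it _
  have hψc : ψ.coeff (k / n) ≠ 0 := coeff_stabPoly_ne_zero hρ
  have hα : herm (q (k % n + 1)) (it k).r / (it k).c =
      moment n A q v k P / moment n A q v k (X * Q) := by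
    rw [hQ.c_eq_mul hn hψd, hP.u_eq, herm_evalVec_mul_eq_coeff hn hψd hP.moment_eq,
      mul_div_mul_left _ _ hψc]
  rw [hstep, step_u]
  set α := herm (q (k % n + 1)) (it k).r / (it k).c
  refine ⟨P - C α * (X * Q), Y + C α * (ψ * Q), ?_, ?_, fun i hi => ?_, ?_, ?_, ?_⟩
  · refine (natDegree_sub_le_of_le (hP.natDegree_le.trans k.le_succ) ((natDegree_C_mul_le _ _).trans
      (natDegree_mul_le_of_le natDegree_X_le hQ.natDegree_le))).trans ?_
    rw [max_le_iff]; omega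
  · rw [coeff_sub, coeff_C_mul, coeff_X_mul_zero, hP.coeff_zero]; ring
  · rw [map_sub, moment_C_mul]
    rcases Nat.lt_succ_iff_lt_or_eq.1 hi with hi | rfl
    · rw [hP.moment_eq i hi, hQ.moment_eq i hi]; ring
    · rw [hα, div_mul_cancel₀ _ hQ.moment_ne, sub_self]
  · rw [hP.u_eq, hQ.w_eq, show ψ * (P - C α * (X * Q)) = ψ * P - C α * (ψ * (X * Q)) by ring,
      map_sub, evalVec_C_mul]
  · rw [map_add, evalVec_C_mul, ← hP.x_eq, ← hQ.g_eq]; abel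
  · linear_combination hP.mul_add

theorem exists_resRep_full (hn : 1 ≤ n) (hstep : it (k + 1) = step n A q (k + 1) it) {P Y : ℂ[X]}
    (h : ResRep n A q v x₀ (stabPoly n it (k / n)) (k + 1)
      ((it k).x + (herm (q (k % n + 1)) (it k).r / (it k).c) • (it k).g) (it (k + 1)).u P Y) :
    ∃ Y', ResRep n A q v x₀ (stabPoly n it ((k + 1) / n)) (k + 1)
      (it (k + 1)).x (it (k + 1)).r P Y' := by
  rcases lt_or_eq_of_le (Nat.succ_le_of_lt (Nat.mod_lt k hn)) with hk | hk
  · refine ⟨Y, ?_⟩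
    rw [hstep] at h
    rw [hstep, step_x_of_lt hk, step_r_of_lt hk, succ_div_of_mod_lt hk]
    exact h
  · replace hk : k % n + 1 = n := hk
    have hx := step_x_of_eq (A := A) (q := q) (it := it) hk
    have hr := step_r_of_eq (A := A) (q := q) (it := it) hk
    rw [← hstep] at hx hr
    have hψ := stabPoly_succ (n := n) it (k / n)
    rw [← succ_eq_of_mod_eq hk] at hψ
    rw [succ_div_of_mod_eq hk, hψ]
    set ψ := stabPoly n it (k / n)
    set ρ := (it (k + 1)).ρ
    refine ⟨Y - C ρ * (ψ * P), h.natDegree_le, h.coeff_zero, h.moment_eq, ?_, ?_, ?_⟩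
    · rw [hr, h.u_eq, show ψ * (1 + C ρ * X) * P = C ρ * (X * (ψ * P)) + ψ * P by ring, map_add,
        evalVec_C_mul, evalVec_X_mul]
    · rw [map_sub, evalVec_C_mul, ← h.x_eq, ← h.u_eq, hx]; abel
    · linear_combination h.mul_add

theorem exists_dirRep (hn : 1 ≤ n) (hstep : it (k + 1) = step n A q (k + 1) it)
    (hρ : ∀ t < (k + 1) / n, (it ((t + 1) * n)).ρ ≠ 0)
    (hρk : n ≤ k + 1 → (it (k + 1)).ρ = (it ((k + 1) / n * n)).ρ) {P Y : ℂ[X]}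
    (hP : ResRep n A q v x₀ (stabPoly n it ((k + 1) / n)) (k + 1) (it (k + 1)).x (it (k + 1)).r P Y)
    (hQ : ∀ s ≤ k, ∃ Q, DirRep n A q v (stabPoly n it (s / n)) s (it s) Q)
    (hW : (matW n A q v (k + 1)).det ≠ 0) (hS : (matS n A q v (k + 1 + 1)).det ≠ 0) :
    ∃ Q, DirRep n A q v (stabPoly n it ((k + 1) / n)) (k + 1) (it (k + 1)) Q := by
  have hwg := step_wg (A := A) (q := q) (it := it) (k := k) hn _ rfl _ rfl
  have hc := step_c (n := n) (A := A) (q := q) (it := it) (k := k)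
  rw [← hstep] at hwg hc
  have hle : (k + 1) / n * n ≤ k + 1 := Nat.div_mul_le_self _ _
  have hlt : k + 1 < (k + 1) / n * n + n := Nat.lt_div_mul_add hn
  have hdiv : ∀ {s j : ℕ}, j * n ≤ s → s < j * n + n → s / n = j := fun {s j} h1 h2 =>
    Nat.div_eq_of_lt_le h1 (by rwa [Nat.succ_mul])
  obtain ⟨B₁, hB₁, hTB₁, hg⟩ : ∃ B : ℂ[X], B.degree < (k + 1 : ℕ) ∧
      (∀ i < (k + 1) / n * n, moment n A q v i (X * (P + B)) = 0) ∧
      (loop n q it (k + 1 - n) ((k + 1) / n * n) ((it (k + 1)).r, 0)).1 + (1 / (it (k + 1)).ρ) •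
        (loop n q it (k + 1 - n) ((k + 1) / n * n) ((it (k + 1)).r, 0)).2 =
      evalVec A v (stabPoly n it ((k + 1) / n) * (P + B)) := by
    rcases hj : (k + 1) / n with _ | j
    · refine ⟨0, by simp, by simp, ?_⟩
      rw [hj] at hlt
      rw [zero_mul, show k + 1 - n = 0 by omega, loop_self, hP.u_eq, hj]
      simp
    · rw [hj] at hρ hρk hle hlt
      have hj1 : (j + 1) * n = j * n + n := Nat.succ_mul j n
      have hψ : stabPoly n it (j + 1) = stabPoly n it j * (1 + C (it (k + 1)).ρ * X) := by
        rw [hρk (by omega), stabPoly_succ]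
      have hρ0 : (it (k + 1)).ρ ≠ 0 := by rw [hρk (by omega)]; exact hρ j (by omega)
      set ρ := (it (k + 1)).ρ
      set φ := stabPoly n it j
      have hu := hP.u_eq
      rw [hj, hψ, show φ * (1 + C ρ * X) * P = φ * P + C ρ * (φ * (X * P)) by ring, map_add,
        evalVec_C_mul] at hu
      obtain ⟨B, hB, hTB, hl⟩ := loop_spec (A := A) (v := v) (q := q) (it := it)
        (a := k + 1 - n) (b := (j + 1) * n) (d := j) (ψ := φ) hn (by omega)
        (fun s h1 h2 => hdiv (by omega) (by omega)) (natDegree_stabPoly_le it j)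
        (coeff_stabPoly_ne_zero fun t ht => hρ t (by omega))
        (fun s h1 h2 => by
          have := hQ s (by omega)
          rwa [hdiv (j := j) (by omega) (by omega)] at this)
        (T := P) (fun i hi => by rw [moment_X_mul hn]; exact hP.moment_eq _ (by omega))
        (ρ := ρ) (z := (it (k + 1)).r) (fun s h1 h2 => by
          have hs := Nat.div_add_mod s n
          rw [hdiv (j := j) (by omega) (by omega), mul_comm] at hs
          rw [hu, herm_add, herm_smul, herm_evalVec_mul_eq_zero (Nat.mod_lt s hn)
            (natDegree_stabPoly_le it j) hP.moment_eq (by omega), zero_add]) 0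
      refine ⟨B, hB.trans_le (by exact_mod_cast hle), hTB, ?_⟩
      rw [hl, hu, hψ, zero_add, smul_smul, one_div_mul_cancel hρ0, one_smul,
        show φ * (1 + C ρ * X) * (P + B) =
          φ * P + C ρ * (φ * (X * P)) + C ρ * (φ * (X * B)) + φ * B by ring]
      simp only [map_add, evalVec_C_mul]
  rw [hg] at hwg
  set φ := stabPoly n it ((k + 1) / n)
  have hXφ : A *ᵥ evalVec A v (φ * (P + B₁)) = evalVec A v (φ * (X * (P + B₁))) := by
    rw [← evalVec_X_mul]; congr 1; ring
  obtain ⟨B₂, hB₂, hTB₂, hl⟩ := loop_spec (A := A) (v := v) (q := q) (it := it)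
    (a := (k + 1) / n * n) (b := k + 1) (d := (k + 1) / n) (ψ := φ) hn hle
    (fun s h1 h2 => hdiv h1 (by omega)) (natDegree_stabPoly_le it _)
    (coeff_stabPoly_ne_zero hρ)
    (fun s h1 h2 => by
      have := hQ s (by omega)
      rwa [hdiv h1 (by omega)] at this)
    hTB₁ (ρ := 1) (z := A *ᵥ evalVec A v (φ * (P + B₁))) (fun s h1 h2 => by rw [hXφ, one_mul])
    (evalVec A v (φ * (P + B₁)))
  rw [hl, Prod.mk.injEq, one_smul, one_smul, hXφ, ← map_add, ← map_add, ← mul_add, ← mul_add,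
    ← mul_add] at hwg
  have hB : (B₁ + B₂).degree < (k + 1 : ℕ) := (degree_add_le _ _).trans_lt (max_lt hB₁ hB₂)
  have hdeg : (P + B₁ + B₂).natDegree ≤ k + 1 := by
    rw [add_assoc]
    refine natDegree_le_of_degree_le ((degree_add_le _ _).trans (max_le ?_ hB.le))
    exact degree_le_of_natDegree_le hP.natDegree_le
  refine ⟨P + B₁ + B₂, hdeg, hTB₂, fun h0 => ?_, hwg.2, hwg.1, hc⟩
  have hQ0 : P + B₁ + B₂ = 0 := eq_zero_of_moment_X_mul_eq_zero hS (Nat.lt_succ_of_le hdeg)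
    fun i hi => by
      rcases Nat.lt_succ_iff_lt_or_eq.1 hi with hi | rfl
      exacts [hTB₂ i hi, h0]
  refine hP.not_degree_lt hW ?_
  rwa [eq_neg_of_add_eq_zero_left ((add_assoc _ _ _).symm.trans hQ0), degree_neg]

/-! ### All iterations -/

theorem herm_resRep_eq_zero {ψ P Y : ℂ[X]} {d k i : ℕ} {x u : Vec N}
    (h : ResRep n A q v x₀ ψ k x u P Y) (hψ : ψ.natDegree ≤ d) (hi : i < n) (hk : d * n + i < k) :
    herm (q (i + 1)) u = 0 := by
  rw [h.u_eq, herm_evalVec_mul_eq_zero hi hψ h.moment_eq hk]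

theorem herm_dirRep_eq_zero {ψ Q : ℂ[X]} {d k i : ℕ} {st : Iter N}
    (h : DirRep n A q v ψ k st Q) (hψ : ψ.natDegree ≤ d) (hi : i < n) (hk : d * n + i < k) :
    herm (q (i + 1)) st.w = 0 := by
  rw [h.w_eq, herm_evalVec_mul_eq_zero hi hψ h.moment_eq hk]

theorem DirRep.w_eq_mulVec {ψ Q : ℂ[X]} {k : ℕ} {st : Iter N} (h : DirRep n A q v ψ k st Q) :
    st.w = A *ᵥ st.g := by
  rw [h.w_eq, h.g_eq, ← evalVec_X_mul]; congr 1; ring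

/-- The state after iteration `k` has the expected polynomial representation. -/
structure Regular (n : ℕ) (A : Matrix (Fin N) (Fin N) ℂ) (q : ℕ → Vec N) (v x₀ : Vec N)
    (it : ℕ → Iter N) (k : ℕ) : Prop where
  ρ_spec : ∀ t < k / n, (it ((t + 1) * n)).ρ ≠ 0 ∧ -1 / (it ((t + 1) * n)).ρ ∉ spectrum ℂ A
  ρ_eq : n ≤ k → (it k).ρ = (it (k / n * n)).ρ
  res : ∃ P Y, ResRep n A q v x₀ (stabPoly n it (k / n)) k (it k).x (it k).r P Y
  dir : ∃ Q, DirRep n A q v (stabPoly n it (k / n)) k (it k) Q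

namespace Regular

theorem coeff_ne_zero (h : Regular n A q v x₀ it k) : (stabPoly n it (k / n)).coeff (k / n) ≠ 0 :=
  coeff_stabPoly_ne_zero fun t ht => (h.ρ_spec t ht).1

theorem ρ_ne_zero (hn : 1 ≤ n) (h : Regular n A q v x₀ it k) (hk : n ≤ k) : (it k).ρ ≠ 0 := by
  have h1 : 0 < k / n := Nat.div_pos hk hn
  have h2 := (h.ρ_spec (k / n - 1) (by omega)).1
  rwa [Nat.sub_add_cancel h1, ← h.ρ_eq hk] at h2

theorem c_ne_zero (hn : 1 ≤ n) (h : Regular n A q v x₀ it k) : (it k).c ≠ 0 := by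
  obtain ⟨Q, hQ⟩ := h.dir
  rw [hQ.c_eq_mul hn (natDegree_stabPoly_le it _)]
  exact mul_ne_zero h.coeff_ne_zero hQ.moment_ne

theorem herm_r_ne_zero (hn : 1 ≤ n) (h : Regular n A q v x₀ it k)
    (hW : (matW n A q v (k + 1)).det ≠ 0) : herm (it k).r (q (k % n + 1)) ≠ 0 := by
  obtain ⟨P, Y, hP⟩ := h.res
  rw [Ne, herm_eq_zero_comm, hP.u_eq,
    herm_evalVec_mul_eq_coeff hn (natDegree_stabPoly_le it _) hP.moment_eq]
  exact mul_ne_zero h.coeff_ne_zero (hP.moment_ne hW)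

theorem herm_mulVec_g_ne_zero (hn : 1 ≤ n) (h : Regular n A q v x₀ it k) :
    herm (A *ᵥ (it k).g) (q (k % n + 1)) ≠ 0 := by
  obtain ⟨Q, hQ⟩ := h.dir
  rw [Ne, herm_eq_zero_comm, ← hQ.w_eq_mulVec, ← hQ.c_eq]
  exact h.c_ne_zero hn

theorem perpSpan_r (hn : 1 ≤ n) (h : Regular n A q v x₀ it k) : PerpSpan (it k).r q (k % n) := by
  obtain ⟨P, Y, hP⟩ := h.res
  have := Nat.div_add_mod' k n
  have := Nat.mod_lt k hn
  exact perpSpan_of_forall fun i hi =>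
    herm_resRep_eq_zero hP (natDegree_stabPoly_le it _) (by omega) (by omega)

theorem perpSpan_mulVec_g (hn : 1 ≤ n) (h : Regular n A q v x₀ it k) :
    PerpSpan (A *ᵥ (it k).g) q (k % n) := by
  obtain ⟨Q, hQ⟩ := h.dir
  have := Nat.div_add_mod' k n
  have := Nat.mod_lt k hn
  rw [← hQ.w_eq_mulVec]
  exact perpSpan_of_forall fun i hi =>
    herm_dirRep_eq_zero hQ (natDegree_stabPoly_le it _) (by omega) (by omega)

theorem exists_resRep_half (hn : 1 ≤ n) (hstep : it (k + 1) = step n A q (k + 1) it)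
    (h : Regular n A q v x₀ it k) :
    ∃ P Y, ResRep n A q v x₀ (stabPoly n it (k / n)) (k + 1)
      ((it k).x + (herm (q (k % n + 1)) (it k).r / (it k).c) • (it k).g) (it (k + 1)).u P Y := by
  obtain ⟨P, Y, hP⟩ := h.res
  obtain ⟨Q, hQ⟩ := h.dir
  exact MLBiCGStab.exists_resRep_half hn hstep (fun t ht => (h.ρ_spec t ht).1) hP hQ

theorem perpSpan_u (hn : 1 ≤ n) (hstep : it (k + 1) = step n A q (k + 1) it)
    (h : Regular n A q v x₀ it k) (hk : k % n + 1 = n) : PerpSpan (it (k + 1)).u q n := by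
  obtain ⟨P, Y, hP⟩ := h.exists_resRep_half hn hstep
  have := Nat.div_add_mod' k n
  exact perpSpan_of_forall fun i hi =>
    herm_resRep_eq_zero hP (natDegree_stabPoly_le it _) (by omega) (by omega)

theorem mulVec_u_ne_zero (hn : 1 ≤ n) (hstep : it (k + 1) = step n A q (k + 1) it)
    (h : Regular n A q v x₀ it k) (hS : (matS n A q v (k + 1 + 1)).det ≠ 0) :
    A *ᵥ (it (k + 1)).u ≠ 0 := by
  obtain ⟨P, Y, hP⟩ := h.exists_resRep_half hn hstep
  intro h0
  refine hP.evalVec_X_mul_ne_zero hS (evalVec_eq_zero_of_stabPoly_mul h.ρ_spec ?_)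
  rw [← h0, hP.u_eq, ← evalVec_X_mul]
  congr 1
  ring

theorem zero (hn : 1 ≤ n) {b : Vec N} (hv : v = b - A *ᵥ x₀) (h0 : it 0 = init A b x₀ q)
    (hS : (matS n A q v 1).det ≠ 0) : Regular n A q v x₀ it 0 := by
  refine ⟨fun t ht => absurd ht (by simp), fun h => absurd h (by omega),
    ⟨1, 0, by simp, by simp, by simp, ?_, ?_, ?_⟩, 1, by simp, by simp, fun hm => ?_, ?_, ?_, ?_⟩
  · simp [h0, init, stabPoly_zero, evalVec_one, hv]
  · simp [h0, init]
  · simp [stabPoly_zero]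
  · exact one_ne_zero (eq_zero_of_moment_X_mul_eq_zero hS (P := 1) (by simp) fun i hi => by
      obtain rfl : i = 0 := by omega
      exact hm)
  · simp [h0, init, stabPoly_zero, evalVec_one, hv]
  · rw [Nat.zero_div, stabPoly_zero, one_mul, evalVec_X_mul, evalVec_one, hv, h0, init]
  · rw [h0, init, Nat.zero_mod]

theorem succ (hn : 1 ≤ n) (hstep : it (k + 1) = step n A q (k + 1) it)
    (h : ∀ s ≤ k, Regular n A q v x₀ it s)
    (hρ : k % n + 1 = n → A *ᵥ (it (k + 1)).u ≠ 0 →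
      (it (k + 1)).ρ ≠ 0 ∧ -1 / (it (k + 1)).ρ ∉ spectrum ℂ A)
    (hW : (matW n A q v (k + 1)).det ≠ 0) (hS : (matS n A q v (k + 1 + 1)).det ≠ 0) :
    Regular n A q v x₀ it (k + 1) := by
  have hk := h k le_rfl
  obtain ⟨P, Y, hP⟩ := hk.exists_resRep_half hn hstep
  obtain ⟨Y', hP'⟩ := exists_resRep_full hn hstep hP
  have hu := hk.mulVec_u_ne_zero hn hstep hS
  have hspec : ∀ t < (k + 1) / n,
      (it ((t + 1) * n)).ρ ≠ 0 ∧ -1 / (it ((t + 1) * n)).ρ ∉ spectrum ℂ A := fun t ht => by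
    rcases lt_or_eq_of_le (Nat.succ_le_of_lt (Nat.mod_lt k hn)) with hm | hm
    · rw [succ_div_of_mod_lt hm] at ht
      exact hk.ρ_spec t ht
    · rw [succ_div_of_mod_eq hm] at ht
      rcases Nat.lt_succ_iff_lt_or_eq.1 ht with ht | rfl
      · exact hk.ρ_spec t ht
      · rw [← succ_eq_of_mod_eq hm]
        exact hρ hm hu
  have heq : n ≤ k + 1 → (it (k + 1)).ρ = (it ((k + 1) / n * n)).ρ := fun hnk => by
    rcases lt_or_eq_of_le (Nat.succ_le_of_lt (Nat.mod_lt k hn)) with hm | hm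
    · rw [succ_div_of_mod_lt hm, ← hk.ρ_eq, hstep, step_ρ_of_lt hm]
      by_contra hlt
      rw [Nat.mod_eq_of_lt (by omega)] at hm
      omega
    · rw [succ_div_of_mod_eq hm, ← succ_eq_of_mod_eq hm]
  exact ⟨hspec, heq, ⟨P, Y', hP'⟩, exists_dirRep hn hstep (fun t ht => (hspec t ht).1) heq hP'
    (fun s hs => (h s hs).dir) hW hS⟩

theorem all (hn : 1 ≤ n) {b : Vec N} (hv : v = b - A *ᵥ x₀) (h0 : it 0 = init A b x₀ q)
    (hstep : ∀ k, it (k + 1) = step n A q (k + 1) it) {m : ℕ}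
    (hS : ∀ l < m, (matS n A q v (l + 1)).det ≠ 0) (hW : ∀ l < m, (matW n A q v (l + 1)).det ≠ 0)
    (hρ : ∀ k, k + 1 < m → k % n + 1 = n → A *ᵥ (it (k + 1)).u ≠ 0 →
      (it (k + 1)).ρ ≠ 0 ∧ -1 / (it (k + 1)).ρ ∉ spectrum ℂ A) :
    ∀ k < m, Regular n A q v x₀ it k := by
  intro k
  induction k using Nat.strong_induction_on with
  | _ k ih =>
    intro hk
    rcases k with _ | k
    · exact zero hn hv h0 (hS 0 hk)
    · exact succ hn (hstep k) (fun s hs => ih s (by omega) (by omega)) (hρ k hk)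
        (hW k (by omega)) (hS (k + 1) hk)

end Regular

theorem norm2_sq_ne_zero {u : Vec N} (hu : u ≠ 0) : norm2 u ^ 2 ≠ 0 := by
  refine pow_ne_zero 2 (norm_ne_zero_iff.2 fun h => hu ?_)
  simpa using congrArg WithLp.ofLp h

theorem noBreakdown_succ (hn : 1 ≤ n) (hstep : it (k + 1) = step n A q (k + 1) it)
    (h : ∀ s ≤ k, Regular n A q v x₀ it s)
    (hu : k % n + 1 = n → (it (k + 1)).u = 0 ∨ (A *ᵥ (it (k + 1)).u ≠ 0 ∧ (it (k + 1)).ρ ≠ 0)) :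
    NoBreakdown n A it (k + 1) := by
  refine ⟨fun s _ hs => (h s (by omega)).c_ne_zero hn, fun hm hnk => ?_, fun hm => ?_⟩
  · rw [rIdx_succ] at hm
    rw [hstep, step_ρ_of_lt hm]
    refine (h k le_rfl).ρ_ne_zero hn ?_
    by_contra hlt
    rw [Nat.mod_eq_of_lt (by omega)] at hm
    omega
  · rw [rIdx_succ] at hm
    exact (hu hm).imp_right fun h => ⟨norm2_sq_ne_zero h.1, h.2⟩

end MLBiCGStab

open MLBiCGStab
theorem mainTheorem4 {N : ℕ} (n : ℕ) (hn : 1 ≤ n)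
    (A : Matrix (Fin N) (Fin N) ℂ) (b x₀ : MLBiCGStab.Vec N) (q : ℕ → MLBiCGStab.Vec N)
    (r₀ : MLBiCGStab.Vec N) (hr₀ : r₀ = b - A *ᵥ x₀)
    (ν : ℕ) (hν : ν = MLBiCGStab.minDegree A r₀)
    (hdet : ∏ l ∈ Finset.Icc 1 ν,
      (MLBiCGStab.matS n A q r₀ l).det * (MLBiCGStab.matW n A q r₀ l).det ≠ 0)
    (it : ℕ → MLBiCGStab.Iter N) (hit : it = MLBiCGStab.iter n A b x₀ q)
    -- the parameters computed before iteration `ν` (the defining quotient having sense)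
    (hρ : ∀ k, 1 ≤ k → k < ν → MLBiCGStab.rIdx n k = n → A *ᵥ (it k).u ≠ 0 →
      (it k).ρ ≠ 0 ∧ -1 / (it k).ρ ∉ spectrum ℂ A) :
    -- no breakdown, exact solution
    (∀ k, 1 ≤ k → k ≤ ν → MLBiCGStab.NoBreakdown n A it k) ∧
    A *ᵥ (it ν).x = b ∧
    -- (a)
    (∀ k, 1 ≤ k → k < ν →
      (it k).x - x₀ ∈ MLBiCGStab.krylov A r₀ 0 (MLBiCGStab.gIdx n (k + 1) + k - 1) ∧
      (it k).r = b - A *ᵥ (it k).x ∧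
      (it k).r - r₀ ∈ MLBiCGStab.krylov A r₀ 1 (MLBiCGStab.gIdx n (k + 1) + k)) ∧
    -- (b)
    (∀ k, 1 ≤ k → k < ν → (it k).r ≠ 0) ∧
    (it ν).r = 0 ∧
    -- (c)
    (∀ k, 1 ≤ k → k < ν → MLBiCGStab.rIdx n k < n →
      MLBiCGStab.PerpSpan (it k).r q (MLBiCGStab.rIdx n k) ∧
      MLBiCGStab.herm (it k).r (q (MLBiCGStab.rIdx n k + 1)) ≠ 0) ∧
    (∀ k, 1 ≤ k → k < ν → MLBiCGStab.rIdx n k = n → MLBiCGStab.herm (it k).r (q 1) ≠ 0) ∧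
    -- (d)
    (∀ k, 1 ≤ k → k ≤ ν → MLBiCGStab.rIdx n k = n → MLBiCGStab.PerpSpan (it k).u q n) ∧
    -- (e)
    (∀ k, 1 ≤ k → k < ν → MLBiCGStab.rIdx n k < n →
      MLBiCGStab.PerpSpan (A *ᵥ (it k).g) q (MLBiCGStab.rIdx n k) ∧
      MLBiCGStab.herm (A *ᵥ (it k).g) (q (MLBiCGStab.rIdx n k + 1)) ≠ 0) ∧
    (∀ k, 1 ≤ k → k < ν → MLBiCGStab.rIdx n k = n →
      MLBiCGStab.herm (A *ᵥ (it k).g) (q 1) ≠ 0) := by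


  have hprod := Finset.prod_ne_zero_iff.1 hdet
  have hS : ∀ l < ν, (matS n A q r₀ (l + 1)).det ≠ 0 := fun l hl =>
    left_ne_zero_of_mul (hprod (l + 1) (Finset.mem_Icc.2 ⟨by omega, by omega⟩))
  have hW : ∀ l < ν, (matW n A q r₀ (l + 1)).det ≠ 0 := fun l hl =>
    right_ne_zero_of_mul (hprod (l + 1) (Finset.mem_Icc.2 ⟨by omega, by omega⟩))
  have h0 : it 0 = init A b x₀ q := by rw [hit, iter_zero]
  have hstep : ∀ k, it (k + 1) = step n A q (k + 1) it := fun k => by rw [hit, iter_succ]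
  have hρ' : ∀ k, k + 1 < ν → k % n + 1 = n → A *ᵥ (it (k + 1)).u ≠ 0 →
      (it (k + 1)).ρ ≠ 0 ∧ -1 / (it (k + 1)).ρ ∉ spectrum ℂ A := fun k hk hm =>
    hρ (k + 1) (by omega) hk (by rw [rIdx_succ, hm])
  have hreg := Regular.all hn hr₀ h0 hstep hS hW hρ'
  have hfin : (it ν).r = 0 ∧ A *ᵥ (it ν).x = b ∧ (1 ≤ ν → (it ν).u = 0) := by
    rcases ν with _ | m
    · obtain ⟨p, hp, hpd, hp0⟩ := exists_monic_evalVec_eq_zero A r₀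
      rw [hp.natDegree_eq_zero.1 (hpd.trans hν.symm), evalVec_one] at hp0
      rw [h0]
      rw [hp0] at hr₀
      exact ⟨hr₀.symm, (sub_eq_zero.1 hr₀.symm).symm, fun h => absurd h (by omega)⟩
    · obtain ⟨P, Y, hP⟩ := (hreg m (by omega)).exists_resRep_half hn (hstep m)
      obtain ⟨Y', hP'⟩ := exists_resRep_full hn (hstep m) hP
      have hEP : evalVec A r₀ P = 0 := evalVec_eq_zero_of_moment_eq_zero
        (by rw [← hν]; exact hW m (by omega)) (by rw [← hν]; exact hP.moment_eq)
      have hr : (it (m + 1)).r = 0 := by rw [hP'.u_eq, evalVec_mul, hEP, Matrix.mulVec_zero]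
      refine ⟨hr, ?_, fun _ => by rw [hP.u_eq, evalVec_mul, hEP, Matrix.mulVec_zero]⟩
      have := hP'.eq_sub_mulVec hr₀
      rw [hr] at this
      exact (sub_eq_zero.1 this.symm).symm
  have hr : ∀ k < ν, herm (it k).r (q (k % n + 1)) ≠ 0 := fun k hk =>
    (hreg k hk).herm_r_ne_zero hn (hW k hk)
  have hmod : ∀ k, 1 ≤ k → rIdx n k < n → k % n = rIdx n k := fun k hk hm => by
    obtain ⟨j, rfl⟩ : ∃ j, k = j + 1 := ⟨k - 1, by omega⟩
    rw [rIdx_succ] at hm ⊢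
    rw [Nat.add_mod, Nat.mod_eq_of_lt (show 1 < n by omega), Nat.mod_eq_of_lt hm]
  have hmod' : ∀ k, 1 ≤ k → rIdx n k = n → k % n = 0 := fun k hk hm => by
    obtain ⟨j, rfl⟩ : ∃ j, k = j + 1 := ⟨k - 1, by omega⟩
    rw [rIdx_succ] at hm
    rw [succ_eq_of_mod_eq hm, Nat.mul_mod_left]
  refine ⟨fun k hk1 hk => ?_, hfin.2.1, fun k hk1 hk => ?_, fun k _ hk hk0 => ?_, hfin.1,
    fun k hk1 hk hm => ?_, fun k hk1 hk hm => ?_, fun k hk1 hk hm => ?_, fun k hk1 hk hm => ?_,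
    fun k hk1 hk hm => ?_⟩
  · obtain ⟨k, rfl⟩ : ∃ j, k = j + 1 := ⟨k - 1, by omega⟩
    refine noBreakdown_succ hn (hstep k) (fun s hs => hreg s (by omega)) fun hm => ?_
    rcases hk.lt_or_eq with hk | hk
    · have hu := (hreg k (by omega)).mulVec_u_ne_zero hn (hstep k) (hS (k + 1) hk)
      exact Or.inr ⟨hu, (hρ' k hk hm hu).1⟩
    · exact Or.inl (by rw [hk]; exact hfin.2.2 (by omega))
  · obtain ⟨P, Y, hP⟩ := (hreg k hk).res
    exact ⟨hP.sub_mem_krylov_zero (natDegree_stabPoly_le it _), hP.eq_sub_mulVec hr₀,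
      hP.sub_mem_krylov (natDegree_stabPoly_le it _)⟩
  · exact hr k hk (by rw [herm_eq_zero_comm, hk0, herm_zero])
  · rw [← hmod k hk1 hm]
    exact ⟨(hreg k hk).perpSpan_r hn, hr k hk⟩
  · simpa only [hmod' k hk1 hm, zero_add] using hr k hk
  · obtain ⟨k, rfl⟩ : ∃ j, k = j + 1 := ⟨k - 1, by omega⟩
    rw [rIdx_succ] at hm
    exact (hreg k (by omega)).perpSpan_u hn (hstep k) hm
  · rw [← hmod k hk1 hm]
    exact ⟨(hreg k hk).perpSpan_mulVec_g hn, (hreg k hk).herm_mulVec_g_ne_zero hn⟩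
  · simpa only [hmod' k hk1 hm, zero_add] using (hreg k hk).herm_mulVec_g_ne_zero hn
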